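/- Let $c:\mathbb{R}^m\to\mathbb{R}$ be globally Lipschitz with constant $L_c>0$, and let $F:\mathbb{R}^n\to\mathbb{R}^m$ be continuously differentiable, with Jacobian $\nabla F$ that is $L_F$-Lipschitz in operator norm and with $\nabla F(x)$ surjective for every $x\in\mathbb{R}^n$. Put $h:=c\circ F$, assume that $h$ is bounded below on $\mathbb{R}^n$, and let $\rho>L_cL_F$. For $x\in\mathbb{R}^n$ define the prox-linear model \[ m_x(u):=c\bigl(F(x)+\nabla F(x)(u-x)\bigr)+\tfrac{\rho}{2}\|u-x\|^2 . \] Write $\partial^L$ for the limiting (Mordukhovich) subdifferential: $w\in\partial^L f(x)$ iff there are $x_j\to x$ with $f(x_j)\to f(x)$ and $w_j\to w$ such that $\liminf_{u\to x_j,\,u\ne x_j}\frac{f(u)-f(x_j)-\langle w_j,u-x_j\rangle}{\|u-x_j\|}\ge 0$ for every $j$. Let $\gamma>0$ and $r\in(0,\infty]$, and let $\{x^k\}_{k\ge 0}\subset\mathbb{R}^n$ be any trajectory of the exploration-augmented method: for every $k\ge0$, an oracle returns a point $z^{k+1}\in\mathbb{R}^n$; for a sampled unit vector $v^k$ and a sampled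 finite step size $\hat t^k\in[0,r]$, one sets $y^{k+1}=x^k+\hat t^k v^k$ if $h(x^k+\hat t^k v^k)+\frac{\gamma}{2}(\hat t^k)^2<h(x^k)$, and $y^{k+1}=x^k$ otherwise; and $x^{k+1}\in\operatorname{arg\,min}_{u\in\{y^{k+1},z^{k+1}\}}h(u)$. Assume that the sublevel set $\{x\in\mathbb{R}^n: h(x)\le h(x^0)\}$ is bounded and that, for every $k\ge 0$, the oracle output satisfies \[ 0\in\partial^L m_{x^k}(z^{k+1})\qquad\text{and}\qquad m_{x^k}(z^{k+1})\le m_{x^k}(x^k)=h(x^k). \] Then every accumulation point $x^*$ of $\{x^k\}$ satisfies $0\in\partial^L h(x^*)$. -/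

import Mathlib

open Filter Topology
open scoped NNReal ENNReal

noncomputable section

/-- The regular (Fréchet) subdifferential of a real-valued function `f` at `x`: the vectors `v` with
`liminf_{y → x, y ≠ x} (f y - f x - ⟪v, y - x⟫) / ‖y - x‖ ≥ 0`. -/
def regularSubdifferential {E : Type*} [NormedAddCommGroup E] [InnerProductSpace ℝ E]
    (f : E → ℝ) (x : E) : Set E :=
  {v | ∀ ε : ℝ, 0 < ε → ∀ᶠ y in 𝓝 x, f x + inner ℝ v (y - x) - ε * ‖y - x‖ ≤ f y}

/-- The limiting (Mordukhovich) subdifferential of a real-valued function `f` at `x`: the limits of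
regular subgradients `w j` at points `u j` with `u j → x` and `f (u j) → f x`. -/
def limitingSubdifferential {E : Type*} [NormedAddCommGroup E] [InnerProductSpace ℝ E]
    (f : E → ℝ) (x : E) : Set E :=
  {v | ∃ u w : ℕ → E, Tendsto u atTop (𝓝 x) ∧ Tendsto (fun j => f (u j)) atTop (𝓝 (f x)) ∧
    (∀ j, w j ∈ regularSubdifferential f (u j)) ∧ Tendsto w atTop (𝓝 v)}

/-- The linearization `ℓ(y) = F(x) + ∇F(x)(y - x)` of `F` at `x`. -/
def linearization {E G : Type*} [NormedAddCommGroup E] [NormedSpace ℝ E]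
    [NormedAddCommGroup G] [NormedSpace ℝ G] (F : E → G) (x y : E) : G :=
  F x + fderiv ℝ F x (y - x)

/-- The prox-linear model `m(y) = c(ℓ(y)) + (ρ / 2) ‖y - x‖²` of `c ∘ F` at `x`. -/
def proxLinearModel {E G : Type*} [NormedAddCommGroup E] [NormedSpace ℝ E]
    [NormedAddCommGroup G] [NormedSpace ℝ G] (c : G → ℝ) (F : E → G) (ρ : ℝ) (x y : E) : ℝ :=
  c (linearization F x y) + ρ / 2 * ‖y - x‖ ^ 2

/-- The accepted step size of the random exploration procedure (over the whole space, so that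
every trial point is feasible) at `x` for the sampled direction `v` and sampled step size `t`. -/
def explorationStep {E : Type*} [NormedAddCommGroup E] [NormedSpace ℝ E]
    (h : E → ℝ) (γ : ℝ) (x v : E) (t : ℝ) : ℝ :=
  if h (x + t • v) + γ / 2 * t ^ 2 < h x then t else 0

/-- `x` is a trajectory of the exploration-augmented method for minimizing `h` over the whole space,
with parameters `γ` and `r`, oracle outputs `z (k + 1)` at `x k`, sampled directions `v k` and
sampled step sizes `t k`. The samples are an arbitrary realization: unit vectors
and numbers in `[0, r]` (in `[0, ∞)` if `r = ∞`). The values `y 0` and `z 0` play no role. -/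
structure IsAugmentedTrajectory {E : Type*} [NormedAddCommGroup E] [NormedSpace ℝ E]
    (h : E → ℝ) (γ : ℝ) (r : ℝ≥0∞) (x y z v : ℕ → E) (t : ℕ → ℝ) : Prop where
  direction_norm : ∀ k, ‖v k‖ = 1
  step_nonneg : ∀ k, 0 ≤ t k
  step_le : ∀ k, ENNReal.ofReal (t k) ≤ r
  exploration : ∀ k, y (k + 1) = x k + explorationStep h γ (x k) (v k) (t k) • v k
  selection_mem : ∀ k, x (k + 1) = y (k + 1) ∨ x (k + 1) = z (k + 1)
  selection_le_exploration : ∀ k, h (x (k + 1)) ≤ h (y (k + 1))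
  selection_le_oracle : ∀ k, h (x (k + 1)) ≤ h (z (k + 1))

end

/-! Write `h = c ∘ F`. The model majorizes `h` with slack `(ρ - Lc * LF) / 2 * ‖u - x‖ ^ 2`, so
model decrease and the selection rule give sufficient decrease of `h (x k)`. As `h` is bounded
below, `z (k + 1) - x k` tends to zero (`tendsto_zero_of_sq_le_decrease`).

Near `z (k + 1)` the model has regular subgradients close to zero. After removal of the proximal
term, surjectivity writes such a subgradient as `∇F(x k)* η`, with `η` a regular subgradient of `c`
at the linearized point and `‖η‖ ≤ Lc`. That point need not be `F (u k)`, and regular subgradients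
do not survive a change of base point. But `F` is open at the limit, so the point is exactly `F p`
for some `p` nearby. Hence `∇F(p)* η` is a regular subgradient of `h` at `p`, with error at most `Lc
* LF * ‖p - x k‖`. -/

section RegularSubgradients

variable {E G : Type*} [NormedAddCommGroup E] [InnerProductSpace ℝ E]
  [NormedAddCommGroup G] [InnerProductSpace ℝ G]

theorem eventually_le_of_mem_regularSubdifferential {f : E → ℝ} {x v : E}
    (hv : v ∈ regularSubdifferential f x) (d : E) {ε : ℝ} (hε : 0 < ε) :
    ∀ᶠ s : ℝ in 𝓝[>] 0, f x + s * (inner ℝ v d - ε * ‖d‖) ≤ f (x + s • d) := by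
  have hcont : Tendsto (fun s : ℝ => x + s • d) (𝓝[>] 0) (𝓝 x) := by
    have : ContinuousAt (fun s : ℝ => x + s • d) 0 := by fun_prop
    have h := this.tendsto
    simp only [zero_smul, add_zero] at h
    exact h.mono_left nhdsWithin_le_nhds
  filter_upwards [hcont.eventually (hv ε hε), self_mem_nhdsWithin] with s hs hpos
  have hpos : 0 < s := hpos
  rw [add_sub_cancel_left, inner_smul_right, norm_smul, Real.norm_of_nonneg hpos.le] at hs
  linarith

/-- Along the direction `v` itself, `f` grows at rate almost `‖v‖ ^ 2`, while the Lipschitz bound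
allows `L * ‖v‖`. -/
theorem norm_le_of_mem_regularSubdifferential {f : E → ℝ} {x v : E} {L : ℝ≥0}
    (hf : LipschitzWith L f) (hv : v ∈ regularSubdifferential f x) : ‖v‖ ≤ L := by
  refine le_of_forall_pos_le_add fun ε hε => ?_
  obtain ⟨s, hs, hpos⟩ :=
    ((eventually_le_of_mem_regularSubdifferential hv v hε).and self_mem_nhdsWithin).exists
  have hpos : 0 < s := hpos
  have hlip := (abs_le.1 ((Real.norm_eq_abs _).symm.trans_le (hf.norm_sub_le (x + s • v) x))).2
  rw [add_sub_cancel_left, norm_smul, Real.norm_of_nonneg hpos.le] at hlip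
  rw [real_inner_self_eq_norm_mul_norm] at hs
  rcases (norm_nonneg v).eq_or_lt with h0 | h0
  · rw [← h0]; positivity
  · refine le_of_mul_le_mul_left ?_ (mul_pos hpos h0)
    linarith

theorem inner_eq_zero_of_mem_regularSubdifferential {f : E → ℝ} {x v d : E}
    (hv : v ∈ regularSubdifferential f x) (hd : ∀ s : ℝ, f (x + s • d) = f x) :
    inner ℝ v d = 0 := by
  have key : ∀ e : E, (∀ s : ℝ, f (x + s • e) = f x) → inner ℝ v e ≤ 0 := by
    intro e he
    refine le_of_forall_pos_le_add fun ε hε => ?_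
    have hε' : 0 < ε / (‖e‖ + 1) := by positivity
    obtain ⟨s, hs, hpos⟩ :=
      ((eventually_le_of_mem_regularSubdifferential hv e hε').and self_mem_nhdsWithin).exists
    have hpos : 0 < s := hpos
    rw [he] at hs
    have h1 : inner ℝ v e - ε / (‖e‖ + 1) * ‖e‖ ≤ 0 := by
      by_contra! h
      linarith [mul_pos hpos h]
    have h2 : ε / (‖e‖ + 1) * ‖e‖ ≤ ε := by
      rw [div_mul_eq_mul_div, div_le_iff₀ (by positivity)]
      linarith
    linarith
  refine le_antisymm (key d hd) ?_
  have := key (-d) fun s => by simpa using hd (-s)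
  rw [inner_neg_right] at this
  linarith

/-- Removing the quadratic term from a regular subgradient. -/
theorem sub_mem_regularSubdifferential_of_add_sq {f : E → ℝ} {ρ : ℝ} {a x v : E}
    (hv : v ∈ regularSubdifferential (fun y => f y + ρ / 2 * ‖y - a‖ ^ 2) x) :
    v - ρ • (x - a) ∈ regularSubdifferential f x := by
  intro ε hε
  have hsmall : ∀ᶠ y in 𝓝 x, |ρ| / 2 * ‖y - x‖ < ε / 2 := by
    have : ContinuousAt (fun y => |ρ| / 2 * ‖y - x‖) x := by fun_prop
    exact this.eventually_lt continuousAt_const (by simpa using hε)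
  filter_upwards [hv (ε / 2) (half_pos hε), hsmall] with y hy hs
  have hexp : ‖y - a‖ ^ 2 = ‖x - a‖ ^ 2 + 2 * inner ℝ (x - a) (y - x) + ‖y - x‖ ^ 2 := by
    rw [← norm_add_sq_real]
    congr 2
    abel
  rw [inner_sub_left, inner_smul_left]
  simp only [hexp, RCLike.conj_to_real] at hy ⊢
  have h1 : ρ / 2 * ‖y - x‖ ^ 2 ≤ ε / 2 * ‖y - x‖ := by
    calc ρ / 2 * ‖y - x‖ ^ 2 ≤ |ρ| / 2 * ‖y - x‖ ^ 2 := by gcongr; exact le_abs_self ρ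
      _ = |ρ| / 2 * ‖y - x‖ * ‖y - x‖ := by ring
      _ ≤ ε / 2 * ‖y - x‖ := by gcongr
  linarith

/-- The chain rule for regular subgradients of a composition with a differentiable map. -/
theorem adjoint_mem_regularSubdifferential_comp [CompleteSpace E] [CompleteSpace G]
    {c : G → ℝ} {F : E → G} {A : E →L[ℝ] G} {x : E} {η : G} (hF : HasFDerivAt F A x)
    (hη : η ∈ regularSubdifferential c (F x)) :
    A.adjoint η ∈ regularSubdifferential (c ∘ F) x := by
  intro ε hε
  set K : ℝ := ‖A‖ + 1 with hK
  have hKpos : 0 < K := by positivity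
  -- Half of `ε` pays for the subgradient inequality of `c`, half for the remainder of `F` paired
  -- with `η`. The cap `1` in `e₂` makes `K = ‖A‖ + 1` a local Lipschitz bound for `F` at `x`.
  set e₁ : ℝ := ε / 2 / K
  set e₂ : ℝ := min 1 (ε / 2 / (‖η‖ + 1))
  have he₁ : 0 < e₁ := by positivity
  have he₂ : 0 < e₂ := by positivity
  have hη₂ : ‖η‖ * e₂ ≤ ε / 2 := by
    calc ‖η‖ * e₂ ≤ (‖η‖ + 1) * (ε / 2 / (‖η‖ + 1)) := by
          gcongr
          · linarith
          · exact min_le_right _ _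
      _ = ε / 2 := by field_simp
  filter_upwards [hF.continuousAt.eventually (hη e₁ he₁), hF.isLittleO.def he₂] with y hy hlin
  set R := F y - F x - A (y - x)
  have hR : F y - F x = A (y - x) + R := by simp [R]
  have hRn : ‖F y - F x‖ ≤ K * ‖y - x‖ := by
    rw [hR]
    have h1 : e₂ * ‖y - x‖ ≤ 1 * ‖y - x‖ := by gcongr; exact min_le_left _ _
    calc ‖A (y - x) + R‖ ≤ ‖A‖ * ‖y - x‖ + e₂ * ‖y - x‖ :=
          norm_add_le_of_le (A.le_opNorm _) hlin
      _ ≤ K * ‖y - x‖ := by rw [hK]; linarith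
  have hinner : inner ℝ η (F y - F x) = inner ℝ (A.adjoint η) (y - x) + inner ℝ η R := by
    rw [hR, inner_add_right, ContinuousLinearMap.adjoint_inner_left]
  have h2 : -(ε / 2 * ‖y - x‖) ≤ inner ℝ η R := by
    have h3 := (abs_le.1 (abs_real_inner_le_norm η R)).1
    have h4 : ‖η‖ * ‖R‖ ≤ ε / 2 * ‖y - x‖ := by
      calc ‖η‖ * ‖R‖ ≤ ‖η‖ * (e₂ * ‖y - x‖) := by gcongr
        _ = ‖η‖ * e₂ * ‖y - x‖ := by ring
        _ ≤ ε / 2 * ‖y - x‖ := by gcongr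
    linarith
  have h5 : e₁ * ‖F y - F x‖ ≤ ε / 2 * ‖y - x‖ := by
    calc e₁ * ‖F y - F x‖ ≤ e₁ * (K * ‖y - x‖) := by gcongr
      _ = ε / 2 * ‖y - x‖ := by simp only [e₁]; field_simp
  simp only [Function.comp_apply]
  linarith

/-- Regular subgradients of a composition with a surjective affine map are images under the adjoint
of regular subgradients of the outer function. -/
theorem exists_adjoint_eq_of_mem_regularSubdifferential_comp_affine [CompleteSpace E]
    [CompleteSpace G] [FiniteDimensional ℝ G] {c : G → ℝ} {A : E →L[ℝ] G}
    (hA : Function.Surjective A) {b : G} {a u w : E}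
    (hw : w ∈ regularSubdifferential (fun y => c (b + A (y - a))) u) :
    ∃ η ∈ regularSubdifferential c (b + A (u - a)), A.adjoint η = w := by
  -- A right inverse `B` of `A` lifts perturbations in `G` to perturbations of `u`; the witness is
  -- `η = B* w`.
  obtain ⟨B₀, hB₀⟩ := A.toLinearMap.exists_rightInverse_of_surjective
    (LinearMap.range_eq_top.2 hA)
  set B : G →L[ℝ] E := LinearMap.toContinuousLinearMap B₀
  have hB : ∀ g, A (B g) = g := fun g => LinearMap.congr_fun hB₀ g
  refine ⟨B.adjoint w, ?_, ?_⟩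
  · intro ε hε
    have hε' : 0 < ε / (‖B‖ + 1) := by positivity
    have hcont : Tendsto (fun g => u + B (g - (b + A (u - a)))) (𝓝 (b + A (u - a))) (𝓝 u) := by
      have : ContinuousAt (fun g => u + B (g - (b + A (u - a)))) (b + A (u - a)) := by fun_prop
      simpa [ContinuousAt] using this
    filter_upwards [hcont.eventually (hw _ hε')] with g hg
    have hpt : b + A (u + B (g - (b + A (u - a))) - a) = g := by
      rw [add_sub_right_comm, map_add, hB]
      abel
    rw [hpt, add_sub_cancel_left] at hg
    rw [ContinuousLinearMap.adjoint_inner_left]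
    have h1 : ε / (‖B‖ + 1) * ‖B (g - (b + A (u - a)))‖ ≤ ε * ‖g - (b + A (u - a))‖ := by
      calc ε / (‖B‖ + 1) * ‖B (g - (b + A (u - a)))‖
          ≤ ε / (‖B‖ + 1) * ((‖B‖ + 1) * ‖g - (b + A (u - a))‖) := by
            gcongr
            exact (B.le_opNorm _).trans (by gcongr; linarith)
        _ = ε * ‖g - (b + A (u - a))‖ := by field_simp
    linarith
  · refine ext_inner_right ℝ fun d => ?_
    rw [ContinuousLinearMap.adjoint_inner_left, ContinuousLinearMap.adjoint_inner_left]
    -- `B (A d) - d` lies in the kernel of `A`, where the composition is constant, so `w` is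
    -- orthogonal to it; this is `A* B* w = w`.
    have := inner_eq_zero_of_mem_regularSubdifferential hw (d := B (A d) - d) fun s => by
      simp only [add_sub_right_comm u, map_add, map_smul, map_sub, hB, sub_self, smul_zero,
        add_zero]
    rw [inner_sub_right] at this
    linarith

/-- Diagonal choice with `δ = 1 / (j + 1)`; continuity supplies the convergence of values. -/
theorem mem_limitingSubdifferential_of_forall_pos {f : E → ℝ} {x v : E} (hf : ContinuousAt f x)
    (h : ∀ δ : ℝ, 0 < δ → ∃ u, dist u x < δ ∧ ∃ w ∈ regularSubdifferential f u, dist w v < δ) :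
    v ∈ limitingSubdifferential f x := by
  choose u hu w hw hwv using fun j : ℕ => h (1 / ((j : ℝ) + 1)) (by positivity)
  have hux : Tendsto u atTop (𝓝 x) := tendsto_iff_dist_tendsto_zero.2 <|
    squeeze_zero (fun _ => dist_nonneg) (fun j => (hu j).le) tendsto_one_div_add_atTop_nhds_zero_nat
  exact ⟨u, w, hux, hf.tendsto.comp hux, hw, tendsto_iff_dist_tendsto_zero.2 <|
    squeeze_zero (fun _ => dist_nonneg) (fun j => (hwv j).le)
      tendsto_one_div_add_atTop_nhds_zero_nat⟩

theorem exists_regularSubgradient_of_mem_limitingSubdifferential {f : E → ℝ} {x v : E}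
    (h : v ∈ limitingSubdifferential f x) {δ : ℝ} (hδ : 0 < δ) :
    ∃ u, dist u x < δ ∧ ∃ w ∈ regularSubdifferential f u, dist w v < δ := by
  obtain ⟨u, w, hu, -, hw, hwv⟩ := h
  obtain ⟨j, hj₁, hj₂⟩ :=
    ((hu.eventually (Metric.ball_mem_nhds x hδ)).and
      (hwv.eventually (Metric.ball_mem_nhds v hδ))).exists
  exact ⟨u j, hj₁, w j, hw j, hj₂⟩

end RegularSubgradients

/-! ### Prox-linear models: majorization, vanishing steps, passage to the limit. -/

section ProxLinear

variable {E G : Type*}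

/-- On the segment from `x` to `u`, the remainder has speed at most `L * ‖d‖ ^ 2 * s`; the mean
value inequality compares it with `L / 2 * ‖d‖ ^ 2 * s ^ 2`. -/
theorem norm_sub_linearization_le [NormedAddCommGroup E] [NormedSpace ℝ E]
    [NormedAddCommGroup G] [NormedSpace ℝ G] {F : E → G} {L : ℝ≥0} (hF : Differentiable ℝ F)
    (hF' : LipschitzWith L (fderiv ℝ F)) (x u : E) :
    ‖F u - linearization F x u‖ ≤ L / 2 * ‖u - x‖ ^ 2 := by
  set d := u - x with hd
  set f : ℝ → G := fun s => F (x + s • d) - (F x + s • fderiv ℝ F x d)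
  have hf : ∀ s, HasDerivAt f (fderiv ℝ F (x + s • d) d - fderiv ℝ F x d) s := by
    intro s
    have h1 : HasDerivAt (fun s : ℝ => x + s • d) d s := by
      simpa using ((hasDerivAt_id s).smul_const d).const_add x
    have h2 : HasDerivAt (fun s : ℝ => F x + s • fderiv ℝ F x d) (fderiv ℝ F x d) s := by
      simpa using ((hasDerivAt_id s).smul_const (fderiv ℝ F x d)).const_add (F x)
    exact ((hF (x + s • d)).hasFDerivAt.comp_hasDerivAt s h1).sub h2
  have hB : ∀ s : ℝ, HasDerivAt (fun s : ℝ => L / 2 * ‖d‖ ^ 2 * s ^ 2) (L * ‖d‖ ^ 2 * s) s := by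
    intro s
    refine ((hasDerivAt_pow 2 s).const_mul ((L : ℝ) / 2 * ‖d‖ ^ 2)).congr_deriv ?_
    norm_num
    ring
  have key := image_norm_le_of_norm_deriv_right_le_deriv_boundary (a := 0) (b := 1)
    (fun s _ => (hf s).continuousAt.continuousWithinAt) (fun s _ => (hf s).hasDerivWithinAt)
    (by simp [f]) hB (fun s hs => by
      rw [← sub_apply]
      calc _ ≤ ‖fderiv ℝ F (x + s • d) - fderiv ℝ F x‖ * ‖d‖ := ContinuousLinearMap.le_opNorm _ _
        _ ≤ L * ‖x + s • d - x‖ * ‖d‖ := by gcongr; exact hF'.norm_sub_le _ _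
        _ = L * ‖d‖ ^ 2 * s := by
          rw [add_sub_cancel_left, norm_smul, Real.norm_of_nonneg hs.1]
          ring) (Set.right_mem_Icc.2 zero_le_one)
  simpa [f, linearization, hd] using key

theorem comp_add_sq_le_proxLinearModel [NormedAddCommGroup E] [NormedSpace ℝ E]
    [NormedAddCommGroup G] [NormedSpace ℝ G] {c : G → ℝ} {F : E → G} {K L : ℝ≥0}
    (hc : LipschitzWith K c) (hF : Differentiable ℝ F) (hF' : LipschitzWith L (fderiv ℝ F))
    (ρ : ℝ) (x u : E) :
    c (F u) + (ρ - K * L) / 2 * ‖u - x‖ ^ 2 ≤ proxLinearModel c F ρ x u := by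
  have h1 := (le_abs_self _).trans ((Real.norm_eq_abs _).symm.trans_le
    (hc.norm_sub_le (F u) (linearization F x u)))
  have h2 : (K : ℝ) * ‖F u - linearization F x u‖ ≤ K * (L / 2 * ‖u - x‖ ^ 2) := by
    gcongr
    exact norm_sub_linearization_le hF hF' x u
  rw [proxLinearModel]
  linarith

theorem proxLinearModel_self [NormedAddCommGroup E] [NormedSpace ℝ E]
    [NormedAddCommGroup G] [NormedSpace ℝ G] (c : G → ℝ) (F : E → G) (ρ : ℝ) (x : E) :
    proxLinearModel c F ρ x x = c (F x) := by
  simp [proxLinearModel, linearization]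

/-- If a nonnegative multiple of `‖p k‖²` is bounded by the decrease of a sequence that is bounded
below, then `p` tends to zero. -/
theorem tendsto_zero_of_sq_le_decrease [NormedAddCommGroup E] {a : ℕ → ℝ}
    {p : ℕ → E} {κ : ℝ} (hκ : 0 < κ) (ha : BddBelow (Set.range a))
    (h : ∀ k, a (k + 1) + κ * ‖p k‖ ^ 2 ≤ a k) : Tendsto p atTop (𝓝 0) := by
  have hanti : Antitone a := antitone_nat_of_succ_le fun k => by
    have : 0 ≤ κ * ‖p k‖ ^ 2 := by positivity
    linarith [h k]
  have hlim := tendsto_atTop_ciInf hanti ha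
  have hdiff : Tendsto (fun k => (a k - a (k + 1)) / κ) atTop (𝓝 0) := by
    simpa using (hlim.sub (hlim.comp (tendsto_add_atTop_nat 1))).div_const κ
  have hsq : Tendsto (fun k => ‖p k‖ ^ 2) atTop (𝓝 0) :=
    squeeze_zero (fun _ => by positivity)
      (fun k => by rw [le_div_iff₀ hκ]; linarith [h k]) hdiff
  rw [tendsto_zero_iff_norm_tendsto_zero]
  simpa [Real.sqrt_sq] using hsq.sqrt

/-- Limits of approximately stationary points of the prox-linear models with surjective
linearizations are stationary for the composition. -/
theorem zero_mem_limitingSubdifferential_comp_of_tendsto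
    [NormedAddCommGroup E] [InnerProductSpace ℝ E] [CompleteSpace E]
    [NormedAddCommGroup G] [InnerProductSpace ℝ G] [FiniteDimensional ℝ G]
    {c : G → ℝ} {F : E → G} {K L : ℝ≥0}
    (hc : LipschitzWith K c) (hF : ContDiff ℝ 1 F) (hF' : LipschitzWith L (fderiv ℝ F))
    (hsurj : ∀ u, Function.Surjective (fderiv ℝ F u)) {ρ : ℝ} {x u w : ℕ → E} {a : E}
    (hx : Tendsto x atTop (𝓝 a)) (hu : Tendsto u atTop (𝓝 a))
    (hw : ∀ k, w k ∈ regularSubdifferential (proxLinearModel c F ρ (x k)) (u k))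
    (hw0 : Tendsto w atTop (𝓝 0)) :
    0 ∈ limitingSubdifferential (c ∘ F) a := by
  have : CompleteSpace G := FiniteDimensional.complete ℝ G
  have hdiff : Differentiable ℝ F := hF.differentiable one_ne_zero
  refine mem_limitingSubdifferential_of_forall_pos
    (hc.continuous.comp hF.continuous).continuousAt fun δ hδ => ?_
  have hlin : Tendsto (fun k => linearization F (x k) (u k)) atTop (𝓝 (F a)) := by
    have hcont : Continuous fun q : E × E => linearization F q.1 q.2 :=
      (hF.continuous.comp continuous_fst).add
        ((hF'.continuous.comp continuous_fst).clm_apply (continuous_snd.sub continuous_fst))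
    simpa [linearization, Function.comp_def] using
      (hcont.tendsto (a, a)).comp (hx.prodMk_nhds hu)
  have hsub : Tendsto (fun k => w k - ρ • (u k - x k)) atTop (𝓝 0) := by
    simpa using hw0.sub ((hu.sub hx).const_smul ρ)
  -- Both `p` and `x k` will lie within `τ` of `a`, so the Jacobian error is at most `K * L * 2τ`,
  -- which must be at most `δ / 2`; the `+ 1` covers `K * L = 0`.
  set τ : ℝ := min δ (δ / (4 * (K * L + 1)))
  have hτ : 0 < τ := by positivity
  have hτδ : (K : ℝ) * (L * (2 * τ)) ≤ δ / 2 := by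
    calc (K : ℝ) * (L * (2 * τ)) = 2 * (K * L) * τ := by ring
      _ ≤ 2 * (K * L + 1) * (δ / (4 * (K * L + 1))) := by
        gcongr
        · linarith
        · exact min_le_right _ _
      _ = δ / 2 := by field_simp; norm_num
  -- Local openness from the surjective derivative at `a`: the linearized points eventually have
  -- preimages in the ball.
  have hopen : F '' Metric.ball a τ ∈ 𝓝 (F a) := by
    rw [← (hF.contDiffAt.hasStrictFDerivAt one_ne_zero).map_nhds_eq_of_surj
      (LinearMap.range_eq_top.2 (hsurj a))]
    exact image_mem_map (Metric.ball_mem_nhds a hτ)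
  obtain ⟨k, ⟨p, hp, hFp⟩, hxk, hwk⟩ :=
    ((hlin.eventually hopen).and ((hx.eventually (Metric.ball_mem_nhds a hτ)).and
      (hsub.eventually (Metric.ball_mem_nhds 0 (half_pos hδ))))).exists
  obtain ⟨η, hη, hηw⟩ := exists_adjoint_eq_of_mem_regularSubdifferential_comp_affine
    (hsurj (x k)) (sub_mem_regularSubdifferential_of_add_sq (hw k))
  have hηK : ‖η‖ ≤ K := norm_le_of_mem_regularSubdifferential hc hη
  have hηp : η ∈ regularSubdifferential c (F p) := by rw [hFp]; exact hη
  refine ⟨p, (Metric.mem_ball.1 hp).trans_le (min_le_left _ _), (fderiv ℝ F p).adjoint η,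
    adjoint_mem_regularSubdifferential_comp (hdiff p).hasFDerivAt hηp, ?_⟩
  rw [dist_zero_right] at hwk
  have hdist : ‖p - x k‖ ≤ 2 * τ := by
    rw [← dist_eq_norm]
    linarith [dist_triangle_right p (x k) a, Metric.mem_ball.1 hp, Metric.mem_ball.1 hxk]
  have hdecomp : (fderiv ℝ F p).adjoint η
      = (w k - ρ • (u k - x k)) + (fderiv ℝ F p - fderiv ℝ F (x k)).adjoint η := by
    rw [← hηw, map_sub, sub_apply]
    abel
  have herr : ‖(fderiv ℝ F p - fderiv ℝ F (x k)).adjoint η‖ ≤ δ / 2 := by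
    calc _ ≤ ‖(fderiv ℝ F p - fderiv ℝ F (x k)).adjoint‖ * ‖η‖ :=
          ContinuousLinearMap.le_opNorm _ _
      _ = ‖η‖ * ‖fderiv ℝ F p - fderiv ℝ F (x k)‖ := by
          rw [LinearIsometryEquiv.norm_map, mul_comm]
      _ ≤ K * (L * (2 * τ)) := by
          gcongr
          exact (hF'.norm_sub_le _ _).trans (by gcongr)
      _ ≤ δ / 2 := hτδ
  rw [dist_zero_right, hdecomp]
  linarith [norm_add_le (w k - ρ • (u k - x k)) ((fderiv ℝ F p - fderiv ℝ F (x k)).adjoint η)]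

end ProxLinear

theorem theorem6 {n m : ℕ}
    (c : EuclideanSpace ℝ (Fin m) → ℝ)
    (F : EuclideanSpace ℝ (Fin n) → EuclideanSpace ℝ (Fin m))
    (Lc LF : ℝ≥0) (hLc : 0 < Lc) (hc : LipschitzWith Lc c)
    (hF : ContDiff ℝ 1 F) (hF' : LipschitzWith LF (fderiv ℝ F))
    (hsurj : ∀ u, Function.Surjective (fderiv ℝ F u))
    (ρ : ℝ) (hρ : (Lc : ℝ) * (LF : ℝ) < ρ)
    (hbelow : BddBelow (Set.range (c ∘ F)))
    (γ : ℝ) (hγ : 0 < γ) (r : ℝ≥0∞) (hr : 0 < r)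
    (x y z v : ℕ → EuclideanSpace ℝ (Fin n)) (t : ℕ → ℝ)
    (hrun : IsAugmentedTrajectory (c ∘ F) γ r x y z v t)
    (hbdd : Bornology.IsBounded {u | (c ∘ F) u ≤ (c ∘ F) (x 0)})
    (hstat : ∀ k, 0 ∈ limitingSubdifferential (proxLinearModel c F ρ (x k)) (z (k + 1)))
    (hdecr : ∀ k, proxLinearModel c F ρ (x k) (z (k + 1)) ≤ proxLinearModel c F ρ (x k) (x k))
    (xstar : EuclideanSpace ℝ (Fin n)) (hacc : MapClusterPt xstar atTop x) :
    0 ∈ limitingSubdifferential (c ∘ F) xstar := by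

  have hdiff : Differentiable ℝ F := hF.differentiable one_ne_zero
  have hstep : Tendsto (fun k => z (k + 1) - x k) atTop (𝓝 0) := by
    refine tendsto_zero_of_sq_le_decrease (a := fun k => (c ∘ F) (x k))
      (half_pos (sub_pos.2 hρ)) (hbelow.mono ?_) fun k => ?_
    · rintro _ ⟨k, rfl⟩
      exact ⟨x k, rfl⟩
    · have h1 := comp_add_sq_le_proxLinearModel hc hdiff hF' ρ (x k) (z (k + 1))
      have h2 := hdecr k
      have h3 := hrun.selection_le_oracle k
      rw [proxLinearModel_self] at h2
      simp only [Function.comp_apply] at h3 ⊢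
      linarith
  -- Tolerance `1 / (k + 1)` replaces the limiting subgradient `0` at `z (k + 1)` by regular ones,
  -- without moving the limit.
  choose u hu w hw hw0 using fun k : ℕ =>
    exists_regularSubgradient_of_mem_limitingSubdifferential (hstat k)
      (show (0 : ℝ) < 1 / ((k : ℝ) + 1) by positivity)
  have hwlim : Tendsto w atTop (𝓝 0) := tendsto_iff_dist_tendsto_zero.2 <|
    squeeze_zero (fun _ => dist_nonneg) (fun k => (hw0 k).le)
      tendsto_one_div_add_atTop_nhds_zero_nat
  have huz : Tendsto (fun k => u k - z (k + 1)) atTop (𝓝 0) :=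
    tendsto_zero_iff_norm_tendsto_zero.2 <|
      squeeze_zero (fun _ => norm_nonneg _) (fun k => (dist_eq_norm (u k) _ ▸ hu k).le)
        tendsto_one_div_add_atTop_nhds_zero_nat
  obtain ⟨φ, hφ, hxφ⟩ := hacc.tendsto_subseq
  have huφ : Tendsto (u ∘ φ) atTop (𝓝 xstar) := by
    have h := ((huz.add hstep).comp hφ.tendsto_atTop).add hxφ
    simpa [Function.comp_def] using h
  exact zero_mem_limitingSubdifferential_comp_of_tendsto hc hF hF' hsurj hxφ huφ
    (fun j => hw (φ j)) (hwlim.comp hφ.tendsto_atTop)
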